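/- For $0<\alpha\le\beta<2\pi$ let $S_{\alpha,\beta}=\{\rho e^{i\theta}:\rho>0,\ \alpha\le\theta\le\beta\}$, and let $\mathcal S$ be the set of all these (infinite, punctured, closed) sectors of $\mathbb C\setminus\mathbb R_{\ge 0}$. For $A\subset\mathbb C$ and $r>0$ put $A[r]=A\cap\{z:|z|\le r\}$, and let $\partial\mathbb D$ be the unit circle. Pointed domains $(W_\lambda,w_\lambda)$, $\lambda>0$, are said to converge to $(W,w)$ in the Carathéodory sense as $\lambda\to+\infty$ if $w_\lambda\in W_\lambda$ for all large $\lambda$; $w_\lambda\to w$; every compact $K\subset W$ is contained in $W_\lambda$ for all large $\lambda$; and every connected open set $N\ni w$ that is contained in $W_\lambda$ for arbitrarily large $\lambda$ is contained in $W$. Let $U,V$ be simply connected open subsets of $\mathbb C$ such that $(\lambda U,-1)\to(\mathbb C\setminus\mathbb R_{\ge0},-1)$ and $(\lambda V,-1)\to(\mathbb C\setminus\mathbb R_{\ge0},-1)$ in the Carathéodory sense as $\lambda\to+\infty$. Let $d_U$ be the hyperbolic distance of $U$. Let $(x_n)_{n\ge0}$ be a sequence of points of $U$, all contained in one sector $S_X\in\mathcal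 S$, with $x_n\to0$ and $d_U(x_n,x_{n+1})\to0$. Let $\phi:U\to V$ be holomorphic, and suppose that there is a real $\lambda_0>0$ with $\phi(x_n)\sim\lambda_0x_n$ as $n\to\infty$. Then $0$ belongs to the boundaries of $U$ and of $V$, and: 1. for every $S\in\mathcal S$, $\phi(z)\sim\lambda_0z$ as $z\to0$, $z\in S$; 2. for all $S',S\in\mathcal S$ such that $S'\cap\partial\mathbb D$ is contained in the interior of $S$, there exist $r,r'>0$ such that $S[r]\subset U$, $S'[r']\subset V$ and $S'[r']\subset\phi(S[r])$. -/

import Mathlib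

open Set Filter Topology Asymptotics
open scoped Pointwise UpperHalfPlane ENNReal

namespace CaraSector

/-- The slit plane `ℂ ∖ ℝ_{≥ 0}`, the complement of the closed ray of nonnegative reals. -/
def slit : Set ℂ := ((fun x : ℝ => (x : ℂ)) '' Ici 0)ᶜ

/-- The infinite punctured closed sector `{ρ e^{iθ} : ρ > 0, α ≤ θ ≤ β}` with vertex `0`. -/
def sector (α β : ℝ) : Set ℂ :=
  {z | ∃ ρ : ℝ, 0 < ρ ∧ ∃ θ ∈ Icc α β, z = ρ * Complex.exp (θ * Complex.I)}

/-- The set of all infinite punctured closed sectors at `0` contained in `ℂ ∖ ℝ_{≥ 0}`. -/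
def sectors : Set (Set ℂ) :=
  {S | ∃ α β : ℝ, 0 < α ∧ α ≤ β ∧ β < 2 * Real.pi ∧ S = sector α β}

/-- The truncation `A[r]`, the intersection of `A` with the closed disc of radius `r` at `0`. -/
def trunc (A : Set ℂ) (r : ℝ) : Set ℂ := A ∩ Metric.closedBall 0 r

/-- Carathéodory convergence of pointed plane domains `(W i, w i)` to `(W', w')` along a filter:
the base points converge, every compact subset of the limit is eventually contained in the domains,
and every connected open neighbourhood of `w'` that is contained in `W i` for a cofinal set
of indices is contained in the limit. -/
structure CaratheodoryTendsto {ι : Type*} (W : ι → Set ℂ) (w : ι → ℂ) (l : Filter ι)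
    (W' : Set ℂ) (w' : ℂ) : Prop where
  eventually_mem : ∀ᶠ i in l, w i ∈ W i
  tendsto_base : Tendsto w l (𝓝 w')
  eventually_subset : ∀ K : Set ℂ, IsCompact K → K ⊆ W' → ∀ᶠ i in l, K ⊆ W i
  subset_of_frequently : ∀ N : Set ℂ, IsOpen N → IsConnected N → w' ∈ N →
    (∃ᶠ i in l, N ⊆ W i) → N ⊆ W'

/-- `f` is a conformal isomorphism of the upper half-plane onto `U` (a Riemann map of `U`;
the inverse of a holomorphic bijection between open sets is automatically holomorphic). -/
def IsRiemannMap (U : Set ℂ) (f : ℂ → ℂ) : Prop :=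
  DifferentiableOn ℂ f {ζ : ℂ | 0 < ζ.im} ∧ BijOn f {ζ : ℂ | 0 < ζ.im} U

/-- The hyperbolic distance of a simply connected domain `U ≠ ℂ`: the hyperbolic distance of the
upper half-plane, transported to `U` by a Riemann map. The value does not depend on
the Riemann map (two of them differ by an isometry of the half-plane), so the infimum below is
over a single value when `z, w ∈ U` (and it is `∞` when `z` or `w` is outside `U`). -/
noncomputable def hyperbolicDist (U : Set ℂ) (z w : ℂ) : ℝ≥0∞ :=
  ⨅ (f : ℂ → ℂ) (_ : IsRiemannMap U f) (a : ℍ) (b : ℍ) (_ : f a = z) (_ : f b = w), edist a b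

end CaraSector

namespace CaraSector

open Metric Complex

/-! Put `φ_t(z) = φ(tz)/t`. Both conclusions follow once `φ_t(z) → lam * z` locally uniformly on
`slit` as `t → 0+`.

Normality comes from a square root. Since `0 ∉ V` and `V` is simply connected, `t⁻¹V` carries a
holomorphic root `G t` with `G t (-1) = I`. It agrees with `slitSqrt` on each compact subset of
`slit` for small `t`, so it takes every value near `I` there; as `G t` cannot take both `w` and `-w`
for `w ≠ 0`, it avoids a disc about `-I`. Hence `(G t + I)⁻¹` is bounded by 2
(`exists_rescaled_sqrt`), and the functions `(G t ∘ φ_t + I)⁻¹` form a normal family.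

The same bounded functions on `U`, with the Schwarz lemma, turn `d_U(x_n, x_{n+1}) → 0` into
`x_{n+1} - x_n = o(|x_n|)`. So the moduli `|x_n|` come within a factor tending to 1 of every small
scale. Every limit of the normal family therefore agrees with the expected one at some point of each
modulus `s > 0`. These points accumulate in `slit`, and the identity theorem determines the limit
(`tendsto_rescaled_map`).

Asymptotics in a sector then follow by compactness of its arc of directions, and the covering
statement from a quantitative open mapping theorem. -/

/-! ### The slit plane and its square root. -/

theorem mem_slit_iff {z : ℂ} : z ∈ slit ↔ -z ∈ slitPlane := by
  simp only [slit, mem_compl_iff, mem_image, mem_Ici, mem_slitPlane_iff, neg_re, neg_im]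
  constructor
  · intro h
    by_contra! hc
    exact h ⟨z.re, by linarith [hc.1], Complex.ext (by simp) (by simpa [eq_comm] using hc.2)⟩
  · rintro h ⟨x, hx, rfl⟩
    simp at h
    linarith

theorem slit_eq_neg_preimage : slit = Neg.neg ⁻¹' slitPlane := by
  ext z; exact mem_slit_iff

theorem isOpen_slit : IsOpen slit := by
  rw [slit_eq_neg_preimage]; exact isOpen_slitPlane.preimage continuous_neg

theorem neg_one_mem_slit : (-1 : ℂ) ∈ slit := by simp [mem_slit_iff]

theorem ne_zero_of_mem_slit {z : ℂ} (hz : z ∈ slit) : z ≠ 0 := by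
  rintro rfl; simp [mem_slit_iff] at hz

theorem ofReal_mul_mem_slit {z : ℂ} (hz : z ∈ slit) {r : ℝ} (hr : 0 < r) : (r : ℂ) * z ∈ slit := by
  rw [mem_slit_iff, mem_slitPlane_iff] at *
  simp at *
  rcases hz with h | h
  · left; nlinarith
  · right; exact ⟨hr.ne', h⟩

/-- Star-shapedness about `-1`: equality of two square roots at `-1` propagates along these
segments. -/
theorem segment_mem_slit {z : ℂ} (hz : z ∈ slit) {s : ℝ} (hs : s ∈ Icc (0 : ℝ) 1) :
    (s : ℂ) * z - (1 - s) ∈ slit := by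
  rw [mem_slit_iff, mem_slitPlane_iff] at *
  simp at *
  rcases eq_or_lt_of_le hs.1 with rfl | h0
  · simp
  rcases hz with h | h
  · left; nlinarith
  · right; exact ⟨h0.ne', h⟩

theorem isPreconnected_slit : IsPreconnected slit := by
  have : slit = Neg.neg '' slitPlane := by
    rw [slit_eq_neg_preimage]; simp
  rw [this]
  exact (starConvex_one_slitPlane.isPathConnected (by simp)).isConnected.isPreconnected.image _
    continuous_neg.continuousOn

/-- The branch of the square root on `slit` with values in the upper half-plane. -/
noncomputable def slitSqrt (z : ℂ) : ℂ := I * (-z) ^ (1 / 2 : ℂ)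

theorem slitSqrt_sq (z : ℂ) : slitSqrt z ^ 2 = z := by
  have : ((-z) ^ (1 / 2 : ℂ)) ^ 2 = -z := by
    rw [← cpow_mul_nat]; norm_num
  rw [slitSqrt, mul_pow, this]; simp

theorem slitSqrt_neg_one : slitSqrt (-1) = I := by simp [slitSqrt]

theorem differentiableOn_slitSqrt : DifferentiableOn ℂ slitSqrt slit := fun _ hz =>
  (((differentiableAt_id.neg).cpow_const (mem_slit_iff.1 hz)).const_mul I).differentiableWithinAt

theorem slitSqrt_im_pos {z : ℂ} (hz : z ∈ slit) : 0 < (slitSqrt z).im := by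
  have hz' := mem_slit_iff.1 hz
  have h0 := slitPlane_ne_zero hz'
  have ha : |(-z).arg| < Real.pi :=
    lt_of_le_of_ne (abs_arg_le_pi _) fun h => by
      rcases abs_eq Real.pi_pos.le |>.1 h with h | h
      · exact (mem_slitPlane_iff_arg.1 hz').1 h
      · exact absurd h (neg_pi_lt_arg _).ne'
  rw [abs_lt] at ha
  simp only [slitSqrt, mul_im, I_re, I_im, zero_mul, one_mul, zero_add]
  rw [cpow_def_of_ne_zero h0, exp_re]
  refine mul_pos (Real.exp_pos _) (Real.cos_pos_of_mem_Ioo ?_)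
  have : (log (-z) * (1 / 2)).im = (-z).arg / 2 := by
    simp [mul_im, log_im]; ring
  rw [this]
  constructor <;> linarith

theorem slitSqrt_ne_zero {z : ℂ} (hz : z ∈ slit) : slitSqrt z ≠ 0 := by
  intro h; have := slitSqrt_im_pos hz; simp [h] at this

theorem slitSqrt_add_I_ne_zero {z : ℂ} (hz : z ∈ slit) : slitSqrt z + I ≠ 0 := by
  intro h
  have := slitSqrt_im_pos hz
  have h2 := congrArg Complex.im h
  simp at h2
  linarith

theorem sq_mem_slit {w : ℂ} (hw : 0 < w.im) : w ^ 2 ∈ slit := by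
  rw [mem_slit_iff, mem_slitPlane_iff]
  simp only [sq, neg_re, neg_im, mul_re, mul_im]
  by_cases h : w.re = 0
  · left; simp only [h]; nlinarith
  · right
    have : w.re * w.im ≠ 0 := mul_ne_zero h hw.ne'
    intro h2; apply this; linarith

theorem slitSqrt_of_sq {w : ℂ} (hw : 0 < w.im) : slitSqrt (w ^ 2) = w := by
  rcases sq_eq_sq_iff_eq_or_eq_neg.1 (slitSqrt_sq (w ^ 2)) with h | h
  · exact h
  · have := slitSqrt_im_pos (sq_mem_slit hw)
    rw [h] at this
    simp at this
    linarith

/-! ### Square roots on rescaled domains and Carathéodory convergence. -/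

/-- Normalized square roots on the rescaled domains `t⁻¹ W`, `t → 0`, of a simply connected domain
`W` whose rescalings exhaust `slit`. -/
theorem exists_rescaled_sqrt {W : Set ℂ} (hWo : IsOpen W) (hWs : IsSimplyConnected W)
    (h0 : (0 : ℂ) ∉ W)
    (hC : ∀ K : Set ℂ, IsCompact K → K ⊆ slit → ∀ᶠ t : ℝ in 𝓝[>] 0, ∀ z ∈ K, (t : ℂ) * z ∈ W) :
    ∃ G : ℝ → ℂ → ℂ, (∀ t > 0, ∀ w, G t w ^ 2 = w) ∧
      (∀ t > 0, DifferentiableOn ℂ (G t) {w | (t : ℂ) * w ∈ W}) ∧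
      (∀ K : Set ℂ, IsCompact K → K ⊆ slit → ∀ᶠ t : ℝ in 𝓝[>] 0, EqOn (G t) slitSqrt K) ∧
      ∀ᶠ t : ℝ in 𝓝[>] 0, ∀ w, (t : ℂ) * w ∈ W → 1 / 2 ≤ ‖G t w + I‖ := by
  obtain ⟨g, hgc, hg⟩ := exists_continuousOn_pow_eq hWs hWo (g := id) continuousOn_id
    (by simpa using h0) two_ne_zero
  simp only [id] at hg
  have hgd : ∀ w ∈ W, DifferentiableAt ℂ g w := by
    intro w hw
    have hw0 : g w ≠ 0 := by
      intro h; have := hg w; rw [h] at this; exact h0 (by simpa [← this] using hw)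
    have h1 : HasDerivAt (fun z : ℂ => z ^ 2) (2 * g w) (g w) := by
      simpa using hasDerivAt_pow 2 (g w)
    exact (h1.of_local_left_inverse (hgc.continuousAt (hWo.mem_nhds hw)) (by simpa using hw0)
      (Eventually.of_forall hg)).differentiableAt
  -- The identity `hg` holds at every point, so `-t ∈ W` is not needed.
  have hgt : ∀ t : ℝ, 0 < t → g (-t) ≠ 0 := by
    intro t ht h
    have := hg (-t); rw [h] at this
    have : t = 0 := by simpa using this.symm
    exact ht.ne' this
  -- The factor `I / g (-t)` forces the value `I` at `-1`, and its square `1 / t` undoes the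
  -- scaling.
  set G : ℝ → ℂ → ℂ := fun t w => I * g (t * w) / g (-t) with hG
  have hGsq : ∀ t > 0, ∀ w, G t w ^ 2 = w := by
    intro t ht w
    have : (t : ℂ) ≠ 0 := by exact_mod_cast ht.ne'
    simp only [hG, div_pow, mul_pow, hg]
    field_simp
    simp
  have hGd : ∀ t > 0, DifferentiableOn ℂ (G t) {w | (t : ℂ) * w ∈ W} := by
    intro t ht w hw
    have : DifferentiableAt ℂ (fun w => g (t * w)) w :=
      DifferentiableAt.comp w (hgd _ hw) (differentiableAt_id.const_mul _)
    exact ((this.const_mul I).div_const _).differentiableWithinAt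
  have hGK : ∀ K : Set ℂ, IsCompact K → K ⊆ slit →
      ∀ᶠ t : ℝ in 𝓝[>] 0, EqOn (G t) slitSqrt K := by
    intro K hK hKs
    set q : ℝ × ℂ → ℂ := fun p => (p.1 : ℂ) * p.2 - (1 - p.1) with hq
    have hqc : Continuous q := by fun_prop
    have hK' : IsCompact (q '' (Icc (0 : ℝ) 1 ×ˢ K)) := (isCompact_Icc.prod hK).image hqc
    have hK's : q '' (Icc (0 : ℝ) 1 ×ˢ K) ⊆ slit := by
      rintro _ ⟨⟨s, z⟩, ⟨hs, hz⟩, rfl⟩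
      exact segment_mem_slit (hKs hz) hs
    filter_upwards [hC _ hK' hK's, self_mem_nhdsWithin] with t htW ht w hw
    have hsub : (fun s : ℝ => q (s, w)) '' Icc 0 1 ⊆ q '' (Icc (0 : ℝ) 1 ×ˢ K) := by
      rintro _ ⟨s, hs, rfl⟩
      exact ⟨(s, w), ⟨hs, hw⟩, rfl⟩
    have hpre : IsPreconnected ((fun s : ℝ => q (s, w)) '' Icc 0 1) :=
      isPreconnected_Icc.image _ (by fun_prop)
    refine hpre.eq_of_sq_eq (y := -1) ((hGd t ht).continuousOn.mono fun z hz => htW _ (hsub hz))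
      (differentiableOn_slitSqrt.continuousOn.mono fun z hz => hK's (hsub hz))
      (fun z _ => by simp [hGsq t ht, slitSqrt_sq])
      (fun hz => slitSqrt_ne_zero (hK's (hsub hz))) ⟨0, by simp, by simp [hq]⟩ ?_
      ⟨1, by simp, by simp [hq]⟩
    rw [slitSqrt_neg_one]
    simp only [hG, mul_neg, mul_one]
    rw [mul_div_assoc, div_self (hgt t ht), mul_one]
  refine ⟨G, hGsq, hGd, hGK, ?_⟩
  have hball : ∀ w ∈ closedBall I (1 / 2), 0 < w.im := by
    intro w hw
    rw [mem_closedBall, dist_eq] at hw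
    have := (abs_im_le_norm (w - I)).trans hw
    rw [abs_le] at this
    simp at this
    linarith [this.1]
  have hK : IsCompact ((fun w : ℂ => w ^ 2) '' closedBall I (1 / 2)) :=
    (isCompact_closedBall _ _).image (by fun_prop)
  filter_upwards [hGK _ hK (by rintro _ ⟨w, hw, rfl⟩; exact sq_mem_slit (hball w hw)),
    self_mem_nhdsWithin] with t htK ht v hv
  by_contra! hlt
  -- Here `v = (-G t v) ^ 2` lies in the compact set where `G t = slitSqrt`, so `G t v = -G t v =
  -- 0`, which is not within `1 / 2` of `-I`.
  have hmem : -G t v ∈ closedBall I (1 / 2) := by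
    rw [mem_closedBall, dist_eq, ← norm_neg]
    refine le_trans (le_of_eq ?_) hlt.le
    congr 1; ring
  have h1 := htK ⟨_, hmem, rfl⟩
  simp only at h1
  rw [slitSqrt_of_sq (hball _ hmem), neg_sq, hGsq t ht] at h1
  have h2 : G t v = 0 := self_eq_neg.1 h1
  have := hball _ hmem
  simp [h2] at this

theorem CaratheodoryTendsto.eventually_mul_mem {W : Set ℂ}
    (h : CaratheodoryTendsto (fun t : ℝ => t • W) (fun _ => (-1 : ℂ)) atTop slit (-1))
    {K : Set ℂ} (hK : IsCompact K) (hKs : K ⊆ slit) :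
    ∀ᶠ t : ℝ in 𝓝[>] 0, ∀ z ∈ K, (t : ℂ) * z ∈ W := by
  filter_upwards [tendsto_inv_nhdsGT_zero.eventually (h.eventually_subset K hK hKs),
    self_mem_nhdsWithin] with t ht ht0 z hz
  have := (mem_smul_set_iff_inv_smul_mem₀ (inv_ne_zero (ne_of_gt ht0)) _ _).1 (ht hz)
  simpa using this

/-- Otherwise the dilates would eventually contain the disc of radius 2, which contains both the
base point `-1` and the point `1` of the slit. -/
theorem CaratheodoryTendsto.zero_notMem {W : Set ℂ} (hW : IsOpen W)
    (h : CaratheodoryTendsto (fun t : ℝ => t • W) (fun _ => (-1 : ℂ)) atTop slit (-1)) :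
    (0 : ℂ) ∉ W := by
  intro h0
  obtain ⟨ε, hε, hb⟩ := Metric.isOpen_iff.1 hW 0 h0
  have hfr : ∃ᶠ t : ℝ in atTop, ball (0 : ℂ) 2 ⊆ t • W := by
    refine Eventually.frequently ?_
    filter_upwards [eventually_gt_atTop (2 / ε)] with t ht z hz
    have ht0 : 0 < t := lt_trans (by positivity) ht
    rw [mem_smul_set_iff_inv_smul_mem₀ ht0.ne']
    apply hb
    rw [mem_ball_zero_iff] at *
    rw [norm_smul, norm_inv, Real.norm_of_nonneg ht0.le, inv_mul_lt_iff₀ ht0]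
    rw [div_lt_iff₀ hε] at ht
    linarith
  have := h.subset_of_frequently _ isOpen_ball
    ((convex_ball _ _).isConnected ⟨0, by simp⟩) (by simp) hfr
  have h1 : (1 : ℂ) ∈ slit := this (by simp)
  simp [mem_slit_iff, mem_slitPlane_iff] at h1
  linarith

theorem CaratheodoryTendsto.zero_mem_frontier {W : Set ℂ} (hW : IsOpen W)
    (h : CaratheodoryTendsto (fun t : ℝ => t • W) (fun _ => (-1 : ℂ)) atTop slit (-1)) :
    (0 : ℂ) ∈ frontier W := by
  rw [hW.frontier_eq]
  refine ⟨?_, h.zero_notMem hW⟩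
  have ht : Tendsto (fun t : ℝ => (t : ℂ) * (-1)) (𝓝[>] 0) (𝓝 0) := by
    have : Continuous fun t : ℝ => (t : ℂ) * (-1) := by fun_prop
    simpa using (this.tendsto 0).mono_left nhdsWithin_le_nhds
  refine mem_closure_of_tendsto ht ?_
  filter_upwards [h.eventually_mul_mem isCompact_singleton
    (singleton_subset_iff.2 neg_one_mem_slit)] with t ht using ht _ rfl

/-! ### Hyperbolic steps are small relative to the modulus. -/

/-- Bounded holomorphic functions are uniformly continuous for the hyperbolic distance. -/
theorem norm_sub_le_of_hyperbolicDist_lt {U : Set ℂ} {F : ℂ → ℂ} {M δ : ℝ} (hδ : 0 < δ)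
    (hδ1 : δ ≤ 1) (hF : DifferentiableOn ℂ F U) (hM : ∀ z ∈ U, ‖F z‖ ≤ M) {z w : ℂ}
    (h : hyperbolicDist U z w < ENNReal.ofReal (Real.log (1 + δ))) :
    ‖F w - F z‖ ≤ 2 * M * δ := by
  simp only [hyperbolicDist, iInf_lt_iff] at h
  obtain ⟨f, hf, a, b, rfl, rfl, hab⟩ := h
  -- Euclidean distance from `a` is at most `a.im * (exp d - 1)`, where `d` is the hyperbolic
  -- distance; hence the threshold `log (1 + δ)`.
  have hd : dist (b : ℂ) a ≤ a.im * δ := by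
    refine (UpperHalfPlane.dist_coe_le b a).trans ?_
    have hlog : dist b a < Real.log (1 + δ) := by
      rw [edist_dist, ENNReal.ofReal_lt_ofReal_iff (Real.log_pos (by linarith))] at hab
      rwa [dist_comm]
    have := Real.exp_lt_exp.2 hlog
    rw [Real.exp_log (by linarith)] at this
    exact mul_le_mul_of_nonneg_left (by linarith) a.im_pos.le
  rcases eq_or_ne b a with rfl | hne
  · have := hM _ (hf.2.mapsTo b.im_pos)
    simp only [sub_self, norm_zero]
    have := (norm_nonneg _).trans this
    positivity
  have hsub : ball (a : ℂ) a.im ⊆ {ζ : ℂ | 0 < ζ.im} := by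
    intro ζ hζ
    rw [mem_ball, dist_eq] at hζ
    have := (abs_im_le_norm (ζ - a)).trans_lt hζ
    rw [abs_lt] at this
    simp at this
    simpa using this.1
  have hmaps : MapsTo f (ball (a : ℂ) a.im) U := fun ζ hζ => hf.2.mapsTo (hsub hζ)
  have hcomp : DifferentiableOn ℂ (F ∘ f) (ball (a : ℂ) a.im) := hF.comp (hf.1.mono hsub) hmaps
  have ha := hM _ (hmaps (mem_ball_self a.im_pos))
  have hcl : ∀ ζ ∈ ball (a : ℂ) a.im, (F ∘ f) ζ ∈ closedBall ((F ∘ f) a) (2 * M) := by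
    intro ζ hζ
    rw [mem_closedBall, dist_eq]
    refine (norm_sub_le _ _).trans ?_
    have := hM _ (hmaps hζ)
    simp only [Function.comp]
    linarith
  have hM0 : 0 ≤ M := (norm_nonneg _).trans ha
  -- For `δ = 1` the bound on `dist b a` does not place `b` in the open ball, but the trivial bound
  -- `2 * M` suffices.
  rcases eq_or_lt_of_le hδ1 with h1 | h1
  · have hb := hM _ (hf.2.mapsTo b.im_pos)
    refine (norm_sub_le _ _).trans ?_
    rw [h1]; linarith
  have hbb : (b : ℂ) ∈ ball (a : ℂ) a.im := by
    rw [mem_ball]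
    exact hd.trans_lt (by nlinarith [a.im_pos])
  have := dist_le_div_mul_dist_of_mapsTo_ball hcomp hcl hbb
  rw [dist_eq] at this
  refine this.trans ?_
  calc 2 * M / a.im * dist (b : ℂ) a ≤ 2 * M / a.im * (a.im * δ) := by
        have := a.im_pos
        gcongr
    _ = 2 * M * δ := by field_simp [a.im_pos.ne']

/-- Undoes the Möbius map and the square root, turning closeness of the bounded functions into
closeness of the points `A ^ 2`, `B ^ 2`. -/
theorem norm_sq_sub_sq_le {A B : ℂ} {ε : ℝ} (hA : ‖A‖ = 1) (hA' : A + I ≠ 0) (hB' : B + I ≠ 0)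
    (hε : ε ≤ 1 / 4) (h : ‖(B + I)⁻¹ - (A + I)⁻¹‖ ≤ ε) : ‖B ^ 2 - A ^ 2‖ ≤ 32 * ε := by
  have hAI : ‖A + I‖ ≤ 2 := (norm_add_le _ _).trans (by rw [hA, norm_I]; norm_num)
  have hε0 : 0 ≤ ε := (norm_nonneg _).trans h
  have hAB : ‖B - A‖ ≤ ε * ‖A + I‖ * ‖B + I‖ := by
    have : B - A = -((B + I)⁻¹ - (A + I)⁻¹) * (A + I) * (B + I) := by
      field_simp; ring
    rw [this, norm_mul, norm_mul, norm_neg]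
    gcongr
  have hBI : ‖B + I‖ ≤ ‖A + I‖ + ‖B - A‖ := by
    refine (norm_add_le _ _).trans' (le_of_eq ?_)
    congr 1; ring
  have hBI4 : ‖B + I‖ ≤ 4 := by
    have : ε * ‖A + I‖ * ‖B + I‖ ≤ 1 / 4 * 2 * ‖B + I‖ := by gcongr
    linarith
  have h8 : ‖B - A‖ ≤ 8 * ε := by
    refine hAB.trans ?_
    calc ε * ‖A + I‖ * ‖B + I‖ ≤ ε * 2 * 4 := by gcongr
      _ = 8 * ε := by ring
  have hsum : ‖B + A‖ ≤ 4 := by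
    have : B + A = (B - A) + A + A := by ring
    rw [this]
    refine (norm_add₃_le).trans ?_
    rw [hA]; linarith
  have : B ^ 2 - A ^ 2 = (B - A) * (B + A) := by ring
  rw [this, norm_mul]
  calc ‖B - A‖ * ‖B + A‖ ≤ 8 * ε * 4 := by gcongr
    _ = 32 * ε := by ring

theorem tendsto_sub_div_norm_of_hyperbolicDist {U : Set ℂ} (hUo : IsOpen U)
    (hUs : IsSimplyConnected U)
    (hU : CaratheodoryTendsto (fun t : ℝ => t • U) (fun _ => (-1 : ℂ)) atTop slit (-1))
    {x : ℕ → ℂ} (hxU : ∀ n, x n ∈ U) (hx0 : Tendsto x atTop (𝓝 0))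
    (hxd : Tendsto (fun n => hyperbolicDist U (x n) (x (n + 1))) atTop (𝓝 0)) :
    Tendsto (fun n => (x (n + 1) - x n) / ‖x n‖) atTop (𝓝 0) := by
  have h0 := hU.zero_notMem hUo
  obtain ⟨G, hGsq, hGd, -, hGI⟩ :=
    exists_rescaled_sqrt hUo hUs h0 fun K hK hKs => hU.eventually_mul_mem hK hKs
  have hxne : ∀ n, x n ≠ 0 := fun n h => h0 (h ▸ hxU n)
  have ht : Tendsto (fun n => ‖x n‖) atTop (𝓝[>] 0) :=
    tendsto_nhdsWithin_iff.2 ⟨by simpa using hx0.norm,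
      Eventually.of_forall fun n => norm_pos_iff.2 (hxne n)⟩
  rw [NormedAddGroup.tendsto_nhds_zero]
  intro η hη
  -- With `M = 2` the Schwarz bound is `4 * δ`; it must be at most `1 / 4`, and `32 * (4 * δ)` must
  -- be less than `η`.
  set δ : ℝ := min (1 / 16) (η / 256) with hδ
  have hδ0 : 0 < δ := by positivity
  have hlog : 0 < ENNReal.ofReal (Real.log (1 + δ)) :=
    ENNReal.ofReal_pos.2 (Real.log_pos (by linarith))
  filter_upwards [hxd.eventually (gt_mem_nhds hlog), ht.eventually hGI] with n hn hGn
  have htn : 0 < ‖x n‖ := norm_pos_iff.2 (hxne n)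
  have htc : (‖x n‖ : ℂ) ≠ 0 := by exact_mod_cast htn.ne'
  have hmem : ∀ z ∈ U, (‖x n‖ : ℂ) * (z / ‖x n‖) ∈ U := by
    intro z hz; rwa [mul_div_cancel₀ _ htc]
  have hne : ∀ z ∈ U, G ‖x n‖ (z / ‖x n‖) + I ≠ 0 := by
    intro z hz h
    have := hGn _ (hmem z hz)
    rw [h] at this; norm_num at this
  have hFd : DifferentiableOn ℂ (fun z => (G ‖x n‖ (z / ‖x n‖) + I)⁻¹) U :=
    (((hGd _ htn).comp (differentiableOn_id.div_const _) hmem).add_const _).inv hne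
  have hFM : ∀ z ∈ U, ‖(G ‖x n‖ (z / ‖x n‖) + I)⁻¹‖ ≤ 2 := by
    intro z hz
    rw [norm_inv]
    exact inv_le_of_inv_le₀ (by norm_num) (by simpa using hGn _ (hmem z hz))
  have key := norm_sub_le_of_hyperbolicDist_lt hδ0 ((min_le_left _ _).trans (by norm_num))
    hFd hFM hn
  have hA : ‖G ‖x n‖ (x n / ‖x n‖)‖ = 1 := by
    have : ‖G ‖x n‖ (x n / ‖x n‖)‖ ^ 2 = 1 := by
      rw [← norm_pow, hGsq _ htn, norm_div, norm_real, norm_norm, div_self htn.ne']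
    exact (pow_eq_one_iff_of_nonneg (norm_nonneg _) two_ne_zero).1 this
  have := norm_sq_sub_sq_le hA (hne _ (hxU n)) (hne _ (hxU (n + 1)))
    (by linarith [min_le_left (1 / 16 : ℝ) (η / 256)]) key
  rw [hGsq _ htn, hGsq _ htn, ← sub_div] at this
  have h2 := min_le_right (1 / 16 : ℝ) (η / 256)
  refine this.trans_lt ?_
  rw [← hδ] at h2
  linarith

/-- A sequence tending to `0` whose steps are `o(‖x n‖)` realizes every small modulus
up to a factor tending to `1`. -/
theorem exists_index_norm_div_tendsto_one {x : ℕ → ℂ} (hxne : ∀ n, x n ≠ 0)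
    (hx0 : Tendsto x atTop (𝓝 0))
    (hx : Tendsto (fun n => (x (n + 1) - x n) / ‖x n‖) atTop (𝓝 0)) :
    ∃ N : ℝ → ℕ, Tendsto N (𝓝[>] 0) atTop ∧
      Tendsto (fun τ => ‖x (N τ)‖ / τ) (𝓝[>] 0) (𝓝 1) := by
  set N : ℝ → ℕ := fun τ => sInf {n | ‖x n‖ ≤ τ} with hN
  have hNle : ∀ τ > 0, ‖x (N τ)‖ ≤ τ := by
    intro τ hτ
    have hne : {n | ‖x n‖ ≤ τ}.Nonempty :=
      ((hx0.norm.eventually (gt_mem_nhds (by simpa using hτ))).mono fun n hn => le_of_lt hn).exists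
    exact Nat.sInf_mem hne
  have hNlt : ∀ τ, ∀ n < N τ, τ < ‖x n‖ := fun τ n hn => by
    simpa using Nat.notMem_of_lt_sInf hn
  have hNtop : Tendsto N (𝓝[>] 0) atTop := by
    refine tendsto_atTop.2 fun m => ?_
    have : ∀ᶠ τ : ℝ in 𝓝[>] 0, ∀ n ∈ Finset.range m, τ < ‖x n‖ :=
      (Finset.eventually_all _).2 fun n _ =>
        nhdsWithin_le_nhds (gt_mem_nhds (norm_pos_iff.2 (hxne n)))
    filter_upwards [this, self_mem_nhdsWithin] with τ h hτ
    by_contra! hlt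
    exact absurd (h _ (Finset.mem_range.2 hlt)) (not_lt.2 (hNle τ hτ))
  refine ⟨N, hNtop, ?_⟩
  have hr : Tendsto (fun n => ‖x (n + 1)‖ / ‖x n‖) atTop (𝓝 1) := by
    have h1 : Tendsto (fun n => 1 - ‖(x (n + 1) - x n) / ‖x n‖‖) atTop (𝓝 1) := by
      simpa using hx.norm.const_sub 1
    have h2 : Tendsto (fun n => 1 + ‖(x (n + 1) - x n) / ‖x n‖‖) atTop (𝓝 1) := by
      simpa using hx.norm.const_add 1
    refine tendsto_of_tendsto_of_tendsto_of_le_of_le h1 h2 (fun n => ?_) fun n => ?_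
    all_goals
      have hn : 0 < ‖x n‖ := norm_pos_iff.2 (hxne n)
      simp only [norm_div, norm_real, norm_norm]
      have h3 := abs_norm_sub_norm_le (x (n + 1)) (x n)
      rw [abs_le] at h3
    · rw [le_div_iff₀ hn, sub_mul, div_mul_cancel₀ _ hn.ne']; linarith
    · rw [div_le_iff₀ hn, add_mul, div_mul_cancel₀ _ hn.ne']; linarith
  have hpred : Tendsto (fun τ => N τ - 1) (𝓝[>] 0) atTop :=
    (tendsto_sub_atTop_nat 1).comp hNtop
  -- The index before `N τ` still has modulus above `τ`, so the ratio of consecutive moduli is a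
  -- lower bound.
  refine tendsto_of_tendsto_of_tendsto_of_le_of_le' (hr.comp hpred) tendsto_const_nhds ?_ ?_
  · filter_upwards [hNtop.eventually_ge_atTop 1, self_mem_nhdsWithin] with τ h1 hτ
    simp only [Function.comp, Nat.sub_add_cancel h1]
    exact div_le_div_of_nonneg_left (norm_nonneg _) hτ (hNlt τ _ (by omega)).le
  · filter_upwards [self_mem_nhdsWithin] with τ hτ
    exact (div_le_one hτ).2 (hNle τ hτ)

/-! ### Normal families along ultrafilters. -/

/-- **Montel's theorem** along an ultrafilter. -/
theorem exists_ultrafilter_limit {ι : Type*} (l : Ultrafilter ι) {Ω : Set ℂ} (hΩ : IsOpen Ω)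
    (F : ι → ℂ → ℂ) (M : ℝ)
    (h : ∀ z ∈ Ω, ∃ ρ > 0, ∀ᶠ i in (l : Filter ι),
      DifferentiableOn ℂ (F i) (ball z ρ) ∧ ∀ w ∈ ball z ρ, ‖F i w‖ ≤ M) :
    ∃ k : ℂ → ℂ, DifferentiableOn ℂ k Ω ∧
      ∀ z ∈ Ω, ∀ y : ι → ℂ, Tendsto y l (𝓝 z) → Tendsto (fun i => F i (y i)) l (𝓝 (k z)) := by
  have hpt : ∀ z, ∃ y, z ∈ Ω → Tendsto (fun i => F i z) l (𝓝 y) := by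
    intro z
    by_cases hz : z ∈ Ω
    · obtain ⟨ρ, hρ, hev⟩ := h z hz
      have hmem : ∀ᶠ i in (l : Filter ι), F i z ∈ closedBall (0 : ℂ) M :=
        hev.mono fun i hi => by simpa using hi.2 z (mem_ball_self hρ)
      obtain ⟨y, -, hy⟩ := (isCompact_closedBall (0 : ℂ) M).ultrafilter_le_nhds
        (l.map fun i => F i z) (le_principal_iff.2 hmem)
      exact ⟨y, fun _ => hy⟩
    · exact ⟨0, fun h => absurd h hz⟩
  choose k hk using hpt
  have hlip : ∀ z ∈ Ω, ∃ ρ > 0, ball z ρ ⊆ Ω ∧ ∀ᶠ i in (l : Filter ι),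
      DifferentiableOn ℂ (F i) (ball z ρ) ∧
        ∀ w ∈ ball z ρ, ‖F i w - F i z‖ ≤ 2 * M / ρ * ‖w - z‖ := by
    intro z hz
    obtain ⟨ρ₁, hρ₁, hev⟩ := h z hz
    obtain ⟨ρ₂, hρ₂, hsub⟩ := Metric.isOpen_iff.1 hΩ z hz
    refine ⟨min ρ₁ ρ₂, lt_min hρ₁ hρ₂, (ball_subset_ball (min_le_right _ _)).trans hsub, ?_⟩
    filter_upwards [hev] with i hi
    have hsub' : ball z (min ρ₁ ρ₂) ⊆ ball z ρ₁ := ball_subset_ball (min_le_left _ _)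
    refine ⟨hi.1.mono hsub', fun w hw => ?_⟩
    have := dist_le_div_mul_dist_of_mapsTo_ball (hi.1.mono hsub') (R₂ := 2 * M) (fun u hu => by
      rw [mem_closedBall, dist_eq]
      refine (norm_sub_le _ _).trans ?_
      linarith [hi.2 u (hsub' hu), hi.2 z (mem_ball_self hρ₁)]) hw
    simpa [dist_eq] using this
  -- The Lipschitz bound, uniform in `i`, upgrades pointwise limits to joint convergence with moving
  -- points.
  have hconv : ∀ z ∈ Ω,
      Tendsto (fun p : ι × ℂ => F p.1 p.2) ((l : Filter ι) ×ˢ 𝓝 z) (𝓝 (k z)) := by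
    intro z hz
    obtain ⟨ρ, hρ, -, hev⟩ := hlip z hz
    have h1 : Tendsto (fun p : ι × ℂ => F p.1 z) ((l : Filter ι) ×ˢ 𝓝 z) (𝓝 (k z)) :=
      (hk z hz).comp tendsto_fst
    have h2 : Tendsto (fun p : ι × ℂ => F p.1 p.2 - F p.1 z) ((l : Filter ι) ×ˢ 𝓝 z) (𝓝 0) := by
      have hb : Tendsto (fun p : ι × ℂ => 2 * M / ρ * ‖p.2 - z‖) ((l : Filter ι) ×ˢ 𝓝 z)
          (𝓝 0) := by
        have : Continuous fun w : ℂ => 2 * M / ρ * ‖w - z‖ := by fun_prop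
        have := this.tendsto z
        simp only [sub_self, norm_zero, mul_zero] at this
        exact this.comp tendsto_snd
      refine squeeze_zero_norm' ?_ hb
      filter_upwards [hev.prod_mk (ball_mem_nhds z hρ)] with p hp using hp.1.2 _ hp.2
    simpa using h1.add h2
  have hkc : ContinuousOn k Ω := by
    intro z hz
    obtain ⟨ρ, hρ, hsub, hev⟩ := hlip z hz
    refine ContinuousAt.continuousWithinAt ?_
    rw [ContinuousAt, tendsto_iff_norm_sub_tendsto_zero]
    have hb : Tendsto (fun w : ℂ => 2 * M / ρ * ‖w - z‖) (𝓝 z) (𝓝 0) := by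
      have : Continuous fun w : ℂ => 2 * M / ρ * ‖w - z‖ := by fun_prop
      simpa using this.tendsto z
    refine squeeze_zero' (Eventually.of_forall fun _ => norm_nonneg _) ?_ hb
    filter_upwards [ball_mem_nhds z hρ] with w hw
    exact le_of_tendsto ((hk w (hsub hw)).sub (hk z hz)).norm (hev.mono fun i hi => hi.2 w hw)
  refine ⟨k, fun z hz => ?_, fun z hz y hy => (hconv z hz).comp (tendsto_id.prodMk hy)⟩
  obtain ⟨ρ, hρ, hsub, hev⟩ := hlip z hz
  have hlu : TendstoLocallyUniformlyOn F k l (ball z ρ) := by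
    rw [isOpen_ball.tendstoLocallyUniformlyOn_iff_forall_tendsto]
    intro w hw
    have hkw : Tendsto (fun p : ι × ℂ => k p.2) ((l : Filter ι) ×ˢ 𝓝 w) (𝓝 (k w)) :=
      (hkc.continuousAt (hΩ.mem_nhds (hsub hw))).tendsto.comp tendsto_snd
    exact (hkw.prodMk_nhds (hconv w (hsub hw))).mono_right (nhds_le_uniformity _)
  exact ((hlu.differentiableOn (hev.mono fun i hi => hi.1) isOpen_ball).differentiableAt
    (ball_mem_nhds z hρ)).differentiableWithinAt

/-! ### Sectors and arcs. -/

/-- The unit circle arc spanning `sector α β`. -/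
noncomputable def arc (α β : ℝ) : Set ℂ := (fun θ : ℝ => exp (θ * I)) '' Icc α β

theorem isCompact_arc (α β : ℝ) : IsCompact (arc α β) :=
  isCompact_Icc.image (by fun_prop)

theorem norm_of_mem_arc {α β : ℝ} {u : ℂ} (hu : u ∈ arc α β) : ‖u‖ = 1 := by
  obtain ⟨θ, -, rfl⟩ := hu
  exact norm_exp_ofReal_mul_I θ

theorem arc_subset_slit {α β : ℝ} (hα : 0 < α) (hβ : β < 2 * Real.pi) : arc α β ⊆ slit := by
  rintro _ ⟨θ, ⟨h1, h2⟩, rfl⟩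
  rw [mem_slit_iff, mem_slitPlane_iff]
  simp only [neg_re, neg_im, exp_ofReal_mul_I_re, exp_ofReal_mul_I_im]
  by_cases h : Real.sin θ = 0
  · left
    have : Real.sin (θ - Real.pi) = 0 := by simp [Real.sin_sub_pi, h]
    rw [Real.sin_eq_zero_iff_of_lt_of_lt (by linarith) (by linarith)] at this
    rw [sub_eq_zero.1 this]; simp
  · right; simpa using h

theorem ofReal_mul_mem_sector {α β : ℝ} {u : ℂ} (hu : u ∈ arc α β) {r : ℝ} (hr : 0 < r) :
    (r : ℂ) * u ∈ sector α β := by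
  obtain ⟨θ, hθ, rfl⟩ := hu
  exact ⟨r, hr, θ, hθ, rfl⟩

theorem ofReal_mul_mem_sector_of_mem {α β : ℝ} {z : ℂ} (hz : z ∈ sector α β) {r : ℝ}
    (hr : 0 < r) : (r : ℂ) * z ∈ sector α β := by
  obtain ⟨ρ, hρ, θ, hθ, rfl⟩ := hz
  exact ⟨r * ρ, mul_pos hr hρ, θ, hθ, by push_cast; ring⟩

theorem div_norm_mem_arc {α β : ℝ} {z : ℂ} (hz : z ∈ sector α β) : z / ‖z‖ ∈ arc α β := by
  obtain ⟨ρ, hρ, θ, hθ, rfl⟩ := hz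
  have : (ρ : ℂ) ≠ 0 := by exact_mod_cast hρ.ne'
  refine ⟨θ, hθ, ?_⟩
  rw [norm_mul, norm_exp_ofReal_mul_I, mul_one, norm_real, Real.norm_of_nonneg hρ.le]
  field_simp

theorem ne_zero_of_mem_sector {α β : ℝ} {z : ℂ} (hz : z ∈ sector α β) : z ≠ 0 := by
  obtain ⟨ρ, hρ, θ, hθ, rfl⟩ := hz
  exact mul_ne_zero (by exact_mod_cast hρ.ne') (exp_ne_zero _)

theorem norm_mul_div_norm {z : ℂ} (hz : z ≠ 0) : (‖z‖ : ℂ) * (z / ‖z‖) = z :=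
  mul_div_cancel₀ _ (by simpa using hz)

theorem arc_subset_inter_sphere (α β : ℝ) : arc α β ⊆ sector α β ∩ sphere 0 1 := fun u hu =>
  ⟨by simpa using ofReal_mul_mem_sector hu one_pos, by simpa using norm_of_mem_arc hu⟩

theorem trunc_sector_subset {W : Set ℂ}
    (h : CaratheodoryTendsto (fun t : ℝ => t • W) (fun _ => (-1 : ℂ)) atTop slit (-1))
    {α β : ℝ} (hα : 0 < α) (hβ : β < 2 * Real.pi) :
    ∀ᶠ r : ℝ in 𝓝[>] 0, trunc (sector α β) r ⊆ W := by
  obtain ⟨ε, hε, hsub⟩ := mem_nhdsGT_iff_exists_Ioo_subset.1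
    (h.eventually_mul_mem (isCompact_arc α β) (arc_subset_slit hα hβ))
  filter_upwards [Ioo_mem_nhdsGT hε] with r hr z hz
  have hz0 := ne_zero_of_mem_sector hz.1
  have hzr : ‖z‖ ≤ r := by simpa using hz.2
  have : ‖z‖ ∈ Ioo 0 ε := ⟨norm_pos_iff.2 hz0, hzr.trans_lt hr.2⟩
  have := hsub this _ (div_norm_mem_arc hz.1)
  rwa [norm_mul_div_norm hz0] at this

/-- A sequence in a sector with small steps has, along every ultrafilter of scales `t → 0`, rescaled
limit points of every modulus. -/
theorem exists_rescaled_limit {α β : ℝ} {x : ℕ → ℂ} (hxS : ∀ n, x n ∈ sector α β)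
    {N : ℝ → ℕ} (hN : Tendsto (fun τ => ‖x (N τ)‖ / τ) (𝓝[>] 0) (𝓝 1))
    {ι : Type*} (l : Ultrafilter ι) {t : ι → ℝ} (ht : Tendsto t l (𝓝[>] 0)) {s : ℝ} (hs : 0 < s) :
    ∃ u ∈ arc α β, Tendsto (fun i => x (N (s * t i)) / t i) l (𝓝 (s * u)) := by
  have hst : Tendsto (fun i => s * t i) l (𝓝[>] 0) := by
    rw [tendsto_nhdsWithin_iff] at ht ⊢
    exact ⟨by simpa using ht.1.const_mul s, ht.2.mono fun i hi => mul_pos hs hi⟩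
  have hmem : ∀ᶠ i in (l : Filter ι), x (N (s * t i)) / ‖x (N (s * t i))‖ ∈ arc α β :=
    Eventually.of_forall fun i => div_norm_mem_arc (hxS _)
  obtain ⟨u, hu, hlim⟩ := (isCompact_arc α β).ultrafilter_le_nhds
    (l.map fun i => x (N (s * t i)) / ‖x (N (s * t i))‖) (le_principal_iff.2 hmem)
  refine ⟨u, hu, ?_⟩
  have h1 : Tendsto (fun i => ((‖x (N (s * t i))‖ / (s * t i) : ℝ) : ℂ)) l (𝓝 ((1 : ℝ) : ℂ)) :=
    (continuous_ofReal.tendsto _).comp (hN.comp hst)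
  have h2 := (h1.const_mul (s : ℂ)).mul (show Tendsto _ _ _ from hlim)
  simp only [ofReal_one, mul_one] at h2
  refine h2.congr' ?_
  filter_upwards [ht.eventually self_mem_nhdsWithin] with i hi
  have hxi : (‖x (N (s * t i))‖ : ℂ) ≠ 0 := by simpa using ne_zero_of_mem_sector (hxS _)
  have hti : (t i : ℂ) ≠ 0 := by exact_mod_cast ne_of_gt hi
  have hsc : (s : ℂ) ≠ 0 := by exact_mod_cast hs.ne'
  push_cast
  field_simp

/-! ### The limit of the rescaled maps. -/

/-- Convergence jointly in scale and point encodes locally uniform convergence on `slit`. Passing to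
ultrafilters replaces extraction of subsequences: every limit must be the same function. -/
theorem tendsto_rescaled_map {U V : Set ℂ}
    (hUo : IsOpen U) (hUs : IsSimplyConnected U) (hVo : IsOpen V) (hVs : IsSimplyConnected V)
    (hU : CaratheodoryTendsto (fun t : ℝ => t • U) (fun _ => (-1 : ℂ)) atTop slit (-1))
    (hV : CaratheodoryTendsto (fun t : ℝ => t • V) (fun _ => (-1 : ℂ)) atTop slit (-1))
    {x : ℕ → ℂ} (hxU : ∀ n, x n ∈ U) (hx0 : Tendsto x atTop (𝓝 0))
    (hxd : Tendsto (fun n => hyperbolicDist U (x n) (x (n + 1))) atTop (𝓝 0))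
    {α β : ℝ} (hα : 0 < α) (hβ : β < 2 * Real.pi) (hxS : ∀ n, x n ∈ sector α β)
    {φ : ℂ → ℂ} (hφ : DifferentiableOn ℂ φ U) (hφV : MapsTo φ U V)
    {lam : ℝ} (hlam : 0 < lam)
    (hφx : Tendsto (fun n => φ (x n) / x n) atTop (𝓝 lam)) {z₀ : ℂ} (hz₀ : z₀ ∈ slit) :
    Tendsto (fun p : ℝ × ℂ => φ (p.1 * p.2) / p.1) (𝓝[>] 0 ×ˢ 𝓝 z₀) (𝓝 (lam * z₀)) := by
  obtain ⟨G, hGsq, hGd, hGK, hGI⟩ :=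
    exists_rescaled_sqrt hVo hVs (hV.zero_notMem hVo) fun K hK hKs => hV.eventually_mul_mem hK hKs
  have hxne : ∀ n, x n ≠ 0 := fun n => ne_zero_of_mem_sector (hxS n)
  obtain ⟨N, hNtop, hN⟩ := exists_index_norm_div_tendsto_one hxne hx0
    (tendsto_sub_div_norm_of_hyperbolicDist hUo hUs hU hxU hx0 hxd)
  rw [tendsto_iff_ultrafilter]
  intro l hl
  have ht : Tendsto (fun i : ℝ × ℂ => i.1) l (𝓝[>] 0) := tendsto_fst.mono_left hl
  have hz : Tendsto (fun i : ℝ × ℂ => i.2) l (𝓝 z₀) := tendsto_snd.mono_left hl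
  have ht0 : ∀ᶠ i : ℝ × ℂ in (l : Filter (ℝ × ℂ)), 0 < i.1 := ht.eventually self_mem_nhdsWithin
  set F : ℝ × ℂ → ℂ → ℂ := fun i z => (G i.1 (φ (i.1 * z) / i.1) + I)⁻¹ with hF
  obtain ⟨k, hkd, hky⟩ := exists_ultrafilter_limit l isOpen_slit F 2 (by
    intro z hz
    obtain ⟨ρ, hρ, hsub⟩ := Metric.nhds_basis_closedBall.mem_iff.1 (isOpen_slit.mem_nhds hz)
    refine ⟨ρ, hρ, ?_⟩
    filter_upwards [ht.eventually (hU.eventually_mul_mem (isCompact_closedBall z ρ) hsub),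
      ht.eventually hGI, ht0] with i hi hGi hi0
    have hic : (i.1 : ℂ) ≠ 0 := by exact_mod_cast hi0.ne'
    have hmapU : MapsTo (fun w => (i.1 : ℂ) * w) (ball z ρ) U :=
      fun w hw => hi w (ball_subset_closedBall hw)
    have hmapV : MapsTo (fun w => φ (i.1 * w) / i.1) (ball z ρ) {w | (i.1 : ℂ) * w ∈ V} := by
      intro w hw
      simpa [mul_div_cancel₀ _ hic] using hφV (hmapU hw)
    have hd : DifferentiableOn ℂ (fun w => φ (i.1 * w) / i.1) (ball z ρ) :=
      (hφ.comp (differentiableOn_id.const_mul _) hmapU).div_const _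
    refine ⟨(((hGd _ hi0).comp hd hmapV).add_const _).inv fun w hw h => ?_, fun w hw => ?_⟩
    · have := hGi _ (hmapV hw)
      simp only [Function.comp] at h
      rw [h] at this; norm_num at this
    · simp only [hF, norm_inv]
      exact inv_le_of_inv_le₀ (by norm_num) (by simpa using hGi _ (hmapV hw)))
  set k₀ : ℂ → ℂ := fun z => (slitSqrt (lam * z) + I)⁻¹ with hk₀
  have hk₀d : DifferentiableOn ℂ k₀ slit :=
    ((differentiableOn_slitSqrt.comp (differentiableOn_id.const_mul _)
      fun z hz => ofReal_mul_mem_slit hz hlam).add_const _).inv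
      fun z hz => slitSqrt_add_I_ne_zero (ofReal_mul_mem_slit hz hlam)
  have harc := arc_subset_slit hα hβ
  -- The direction `u` depends on the ultrafilter and is uncontrolled; one point of each modulus is
  -- enough for the identity theorem.
  have hpt : ∀ s : ℝ, 0 < s → ∃ u ∈ arc α β, k (s * u) = k₀ (s * u) := by
    intro s hs
    obtain ⟨u, hu, hlim⟩ := exists_rescaled_limit hxS hN l ht hs
    have he : (s : ℂ) * u ∈ slit := ofReal_mul_mem_slit (harc hu) hs
    refine ⟨u, hu, ?_⟩
    have h1 : Tendsto (fun i => F i (x (N (s * i.1)) / i.1)) l (𝓝 (k (s * u))) :=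
      hky _ he _ hlim
    have hst : Tendsto (fun i : ℝ × ℂ => s * i.1) l (𝓝[>] 0) := by
      rw [tendsto_nhdsWithin_iff] at ht ⊢
      exact ⟨by simpa using ht.1.const_mul s, ht.2.mono fun i hi => mul_pos hs hi⟩
    have hle : (lam : ℂ) * (s * u) ∈ slit := ofReal_mul_mem_slit he hlam
    have h2 : Tendsto (fun i : ℝ × ℂ => φ (x (N (s * i.1))) / i.1) l (𝓝 (lam * (s * u))) := by
      refine ((hφx.comp (hNtop.comp hst)).mul hlim).congr fun i => ?_
      have := hxne (N (s * i.1))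
      simp only [Function.comp]
      field_simp
    obtain ⟨ρ, hρ, hsub⟩ := Metric.nhds_basis_closedBall.mem_iff.1 (isOpen_slit.mem_nhds hle)
    have hsc : ContinuousAt (fun w => (slitSqrt w + I)⁻¹) (lam * (s * u)) :=
      (((differentiableOn_slitSqrt.differentiableAt (isOpen_slit.mem_nhds hle)).continuousAt).add
        continuousAt_const).inv₀ (slitSqrt_add_I_ne_zero hle)
    have h3 : Tendsto (fun i => F i (x (N (s * i.1)) / i.1)) l (𝓝 (k₀ (s * u))) := by
      have h4 : Tendsto (fun i : ℝ × ℂ => (slitSqrt (φ (x (N (s * i.1))) / i.1) + I)⁻¹) l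
          (𝓝 (slitSqrt (lam * (s * u)) + I)⁻¹) := hsc.tendsto.comp h2
      refine h4.congr' ?_
      have h5 : ∀ᶠ i : ℝ × ℂ in (l : Filter (ℝ × ℂ)),
          EqOn (G i.1) slitSqrt (closedBall (lam * (s * u)) ρ) :=
        ht.eventually (hGK _ (isCompact_closedBall _ ρ) hsub)
      have h6 : ∀ᶠ i : ℝ × ℂ in (l : Filter (ℝ × ℂ)),
          φ (x (N (s * i.1))) / i.1 ∈ closedBall ((lam : ℂ) * (s * u)) ρ :=
        h2 (closedBall_mem_nhds _ hρ)
      filter_upwards [h5, h6, ht0] with i hi hmem hi0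
      have hic : (i.1 : ℂ) ≠ 0 := by exact_mod_cast hi0.ne'
      simp only [hF]
      rw [mul_div_cancel₀ _ hic, hi hmem]
    exact tendsto_nhds_unique h1 h3
  choose! u hu hku using hpt
  set e : ℝ → ℂ := fun s => s * u s with he
  -- The points `s * u s` have distinct moduli, hence are infinitely many; they lie in a compact
  -- part of `slit`, so they accumulate there.
  have heinj : InjOn e (Icc 1 2) := by
    intro s hs s' hs' h
    have hs0 : 0 < s := by linarith [hs.1]
    have hs0' : 0 < s' := by linarith [hs'.1]
    have := congrArg norm h
    simpa [he, norm_of_mem_arc (hu s hs0), norm_of_mem_arc (hu s' hs0'), abs_of_pos hs0,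
      abs_of_pos hs0'] using this
  have hKc : IsCompact ((fun p : ℝ × ℂ => (p.1 : ℂ) * p.2) '' Icc (1 : ℝ) 2 ×ˢ arc α β) :=
    (isCompact_Icc.prod (isCompact_arc α β)).image (by fun_prop)
  obtain ⟨a, haK, hacc⟩ := ((Icc_infinite one_lt_two).image heinj).exists_accPt_of_subset_isCompact
    hKc (by
      rintro _ ⟨s, hs, rfl⟩
      exact ⟨(s, u s), ⟨hs, hu s (by linarith [hs.1])⟩, rfl⟩)
  have ha : a ∈ slit := by
    obtain ⟨p, ⟨hp1, hp2⟩, rfl⟩ := haK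
    exact ofReal_mul_mem_slit (harc hp2) (by linarith [hp1.1])
  have hkk : EqOn k k₀ slit := by
    refine (hkd.analyticOnNhd isOpen_slit).eqOn_of_preconnected_of_frequently_eq
      (hk₀d.analyticOnNhd isOpen_slit) isPreconnected_slit ha ?_
    refine (accPt_iff_frequently_nhdsNE.1 hacc).mono ?_
    rintro _ ⟨s, hs, rfl⟩
    exact hku s (by linarith [hs.1])
  have h1 : Tendsto (fun i => F i i.2) l (𝓝 (k₀ z₀)) := by
    rw [← hkk hz₀]
    exact hky _ hz₀ _ hz
  have hne := slitSqrt_add_I_ne_zero (ofReal_mul_mem_slit hz₀ hlam)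
  -- Since `G t w ^ 2 = w`, squaring `F⁻¹ - I` recovers `φ_t`.
  have h2 := ((h1.inv₀ (inv_ne_zero hne)).sub_const I).pow 2
  simp only [hk₀, hF, inv_inv, add_sub_cancel_right, slitSqrt_sq] at h2
  refine h2.congr' ?_
  filter_upwards [ht0] with i hi
  exact hGsq _ hi _

/-! ### Asymptotics in sectors and covering of sectors. -/

theorem isEquivalent_nhdsWithin_sector {φ : ℂ → ℂ} {lam : ℝ} (hlam : 0 < lam) {α β : ℝ}
    (hα : 0 < α) (hβ : β < 2 * Real.pi)
    (h : ∀ z₀ ∈ slit,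
      Tendsto (fun p : ℝ × ℂ => φ (p.1 * p.2) / p.1) (𝓝[>] 0 ×ˢ 𝓝 z₀) (𝓝 (lam * z₀))) :
    φ ~[𝓝[sector α β] 0] (fun z => (lam : ℂ) * z) := by
  have hlc : (lam : ℂ) ≠ 0 := by exact_mod_cast hlam.ne'
  have hmem : ∀ᶠ z in 𝓝[sector α β] (0 : ℂ), z ∈ sector α β := self_mem_nhdsWithin
  rw [isEquivalent_iff_tendsto_one
    (hmem.mono fun z hz => mul_ne_zero hlc (ne_zero_of_mem_sector hz)), tendsto_iff_ultrafilter]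
  intro l hl
  have hlS : ∀ᶠ z in (l : Filter ℂ), z ∈ sector α β := hl hmem
  obtain ⟨u, hu, hlim⟩ := (isCompact_arc α β).ultrafilter_le_nhds (l.map fun z => z / ‖z‖)
    (le_principal_iff.2 (hlS.mono fun z hz => div_norm_mem_arc hz))
  replace hlim : Tendsto (fun z : ℂ => z / ‖z‖) l (𝓝 u) := hlim
  have hus := arc_subset_slit hα hβ hu
  have hnorm : Tendsto (fun z : ℂ => ‖z‖) l (𝓝[>] 0) := by
    refine tendsto_nhdsWithin_iff.2 ⟨?_, hlS.mono fun z hz =>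
      norm_pos_iff.2 (ne_zero_of_mem_sector hz)⟩
    have : Tendsto (fun z : ℂ => ‖z‖) (𝓝 0) (𝓝 0) := by simpa using continuous_norm.tendsto (0 : ℂ)
    exact this.mono_left (hl.trans nhdsWithin_le_nhds)
  have h1 := ((h u hus).comp (hnorm.prodMk hlim)).div (hlim.const_mul (lam : ℂ))
    (mul_ne_zero hlc (ne_zero_of_mem_slit hus))
  rw [div_self (mul_ne_zero hlc (ne_zero_of_mem_slit hus))] at h1
  refine h1.congr' ?_
  filter_upwards [hlS] with z hz
  have hz0 := ne_zero_of_mem_sector hz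
  have hzc : (‖z‖ : ℂ) ≠ 0 := by simpa using hz0
  simp only [Function.comp, Pi.div_apply, norm_mul_div_norm hz0]
  field_simp

/-- A holomorphic map on a closed disc close to `z ↦ c z` attains the value `c z₀`
at the centre `z₀`. -/
theorem mem_image_closedBall_of_near_mul {f : ℂ → ℂ} {z₀ c : ℂ} {δ : ℝ} (hδ : 0 < δ) (hc : c ≠ 0)
    (hf : DiffContOnCl ℂ f (ball z₀ δ))
    (h : ∀ z ∈ closedBall z₀ δ, ‖f z - c * z‖ < ‖c‖ * δ / 8) :
    c * z₀ ∈ f '' closedBall z₀ δ := by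
  have hc0 : 0 < ‖c‖ := norm_pos_iff.2 hc
  have h0 := h z₀ (mem_closedBall_self hδ.le)
  have hlow : ∀ z ∈ closedBall z₀ δ, ‖c‖ * ‖z - z₀‖ - ‖c‖ * δ / 4 < ‖f z - f z₀‖ := by
    intro z hz
    have h1 : c * (z - z₀) = (f z - f z₀) - (f z - c * z) + (f z₀ - c * z₀) := by ring
    have h2 := norm_add_le ((f z - f z₀) - (f z - c * z)) (f z₀ - c * z₀)
    have h3 := norm_sub_le (f z - f z₀) (f z - c * z)
    rw [← h1, norm_mul] at h2
    linarith [h z hz]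
  -- On the sphere `‖f z - f z₀‖` exceeds `3 * ‖c‖ * δ / 4`, hence `ε`. The image then covers the
  -- ball of radius `ε / 2 = ‖c‖ * δ / 4` about `f z₀`, which contains `c * z₀`.
  refine hf.ball_subset_image_closedBall hδ (ε := ‖c‖ * δ / 2) (fun z hz => ?_) ?_ ?_
  · have := hlow z (sphere_subset_closedBall hz)
    rw [mem_sphere, dist_eq] at hz
    rw [hz] at this
    linarith [mul_pos hc0 hδ]
  · by_contra hfr
    simp only [not_frequently, not_not] at hfr
    have hd : EqOn f (fun _ => f z₀) (ball z₀ δ) :=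
      (hf.differentiableOn.analyticOnNhd isOpen_ball).eqOn_of_preconnected_of_eventuallyEq
        analyticOnNhd_const (convex_ball z₀ δ).isPreconnected (mem_ball_self hδ) hfr
    have hmem : z₀ + ((δ / 2 : ℝ) : ℂ) ∈ ball z₀ δ := by
      rw [mem_ball, dist_eq, add_sub_cancel_left, norm_real, Real.norm_of_nonneg (by positivity)]
      linarith
    have := hlow _ (ball_subset_closedBall hmem)
    rw [hd hmem, add_sub_cancel_left, norm_real, Real.norm_of_nonneg (by positivity)] at this
    simp only [sub_self, norm_zero] at this
    linarith [mul_pos hc0 hδ]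
  · rw [mem_ball, dist_comm, dist_eq]
    linarith [mul_pos hc0 hδ]

theorem exists_trunc_subset_image {U V : Set ℂ}
    (hU : CaratheodoryTendsto (fun t : ℝ => t • U) (fun _ => (-1 : ℂ)) atTop slit (-1))
    (hV : CaratheodoryTendsto (fun t : ℝ => t • V) (fun _ => (-1 : ℂ)) atTop slit (-1))
    {φ : ℂ → ℂ} (hφ : DifferentiableOn ℂ φ U) {lam : ℝ} (hlam : 0 < lam)
    (h : ∀ z₀ ∈ slit,
      Tendsto (fun p : ℝ × ℂ => φ (p.1 * p.2) / p.1) (𝓝[>] 0 ×ˢ 𝓝 z₀) (𝓝 (lam * z₀)))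
    {α' β' α β : ℝ} (hα' : 0 < α') (hβ' : β' < 2 * Real.pi) (hα : 0 < α) (hβ : β < 2 * Real.pi)
    (hsub : sector α' β' ∩ sphere 0 1 ⊆ interior (sector α β)) :
    ∃ r r' : ℝ, 0 < r ∧ 0 < r' ∧ trunc (sector α β) r ⊆ U ∧ trunc (sector α' β') r' ⊆ V ∧
      trunc (sector α' β') r' ⊆ φ '' trunc (sector α β) r := by
  obtain ⟨r, hrU, hr⟩ := ((trunc_sector_subset hU hα hβ).and self_mem_nhdsWithin).exists
  have hr0 : 0 < r := hr
  have hlc : (lam : ℂ) ≠ 0 := by exact_mod_cast hlam.ne'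
  -- The interior condition gives a uniform `δ`: discs of radius `δ` about the directions of `S'`
  -- stay in `S` and in `slit`.
  obtain ⟨δ, hδ, hδsub⟩ := (isCompact_arc α' β').exists_cthickening_subset_open
    (isOpen_interior.inter isOpen_slit) (subset_inter
      ((arc_subset_inter_sphere α' β').trans hsub) (arc_subset_slit hα' hβ'))
  set K := cthickening δ (arc α' β') with hK
  have hKc : IsCompact K := (isCompact_arc α' β').cthickening
  have hKslit : K ⊆ slit := hδsub.trans inter_subset_right
  have hKS : K ⊆ sector α β := (hδsub.trans inter_subset_left).trans interior_subset
  have hball : ∀ u ∈ arc α' β', closedBall u δ ⊆ K := fun u hu =>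
    closedBall_subset_cthickening hu δ
  have hunif : TendstoUniformlyOn (fun (t : ℝ) z => φ (t * z) / t) (fun z => (lam : ℂ) * z)
      (𝓝[>] 0) K := by
    refine (tendstoLocallyUniformlyOn_iff_tendstoUniformlyOn_of_compact hKc).1 ?_
    refine TendstoLocallyUniformlyOn.mono ?_ hKslit
    rw [isOpen_slit.tendstoLocallyUniformlyOn_iff_forall_tendsto]
    intro z hz
    have hc : Tendsto (fun p : ℝ × ℂ => (lam : ℂ) * p.2) (𝓝[>] 0 ×ˢ 𝓝 z) (𝓝 (lam * z)) :=
      tendsto_snd.const_mul _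
    exact (hc.prodMk_nhds (h z hz)).mono_right (nhds_le_uniformity _)
  -- The bound `r / (1 + δ)` on `t` keeps `t * z` in the disc of radius `r`, since `‖z‖ ≤ 1 + δ`.
  have hev := ((Metric.tendstoUniformlyOn_iff.1 hunif (lam * δ / 8) (by positivity)).and
    (hU.eventually_mul_mem hKc hKslit)).and (Ioo_mem_nhdsGT (show 0 < r / (1 + δ) by positivity))
  obtain ⟨t₀, ht₀, ht₀sub⟩ := mem_nhdsGT_iff_exists_Ioo_subset.1 hev
  have ht₀' : 0 < t₀ := ht₀
  obtain ⟨r', ⟨hr'V, hr'lt⟩, hr'⟩ := (((trunc_sector_subset hV hα' hβ').and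
    (Ioo_mem_nhdsGT (show 0 < lam * t₀ by positivity))).and self_mem_nhdsWithin).exists
  refine ⟨r, r', hr0, hr', hrU, hr'V, ?_⟩
  rintro w ⟨hwS, hwr⟩
  have hw0 := ne_zero_of_mem_sector hwS
  have hwn : 0 < ‖w‖ := norm_pos_iff.2 hw0
  -- At this scale `w / t = lam * u` with `u = w / ‖w‖`, the value that `φ_t` must attain near `u`.
  set t : ℝ := ‖w‖ / lam with ht
  have ht0 : 0 < t := by positivity
  have htc : (t : ℂ) ≠ 0 := by exact_mod_cast ht0.ne'
  have htlt : t < t₀ := by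
    rw [ht, div_lt_iff₀ hlam]
    have : ‖w‖ ≤ r' := by simpa using hwr
    linarith [hr'lt.2]
  obtain ⟨⟨hnear, hmemU⟩, htr⟩ := ht₀sub ⟨ht0, htlt⟩
  have hu := div_norm_mem_arc hwS
  set u : ℂ := w / ‖w‖ with hudef
  have hmapU : MapsTo (fun z => (t : ℂ) * z) (closedBall u δ) U :=
    fun z hz => hmemU z (hball u hu hz)
  have hUd : ∀ z ∈ closedBall u δ, DifferentiableWithinAt ℂ (fun z => φ (t * z) / t)
      (closedBall u δ) z :=
    (hφ.comp (differentiableOn_id.const_mul _) hmapU).div_const _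
  obtain ⟨z, hz, hzw⟩ := mem_image_closedBall_of_near_mul (f := fun z => φ (t * z) / t) hδ hlc
    ⟨DifferentiableOn.mono hUd ball_subset_closedBall, by
      rw [closure_ball _ hδ.ne']
      exact DifferentiableOn.continuousOn hUd⟩ (fun z hz => by
      have := hnear z (hball u hu hz)
      rw [dist_comm, dist_eq] at this
      simpa [abs_of_pos hlam] using this)
  refine ⟨t * z, ⟨ofReal_mul_mem_sector_of_mem (hKS (hball u hu hz)) ht0, ?_⟩, ?_⟩
  · rw [mem_closedBall_zero_iff, norm_mul, norm_real, Real.norm_of_nonneg ht0.le]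
    have hzn : ‖z‖ ≤ 1 + δ := by
      rw [mem_closedBall, dist_eq] at hz
      have := norm_le_norm_add_norm_sub' z u
      rw [norm_of_mem_arc hu] at this
      linarith
    have := htr.2
    rw [lt_div_iff₀ (by positivity)] at this
    exact (mul_le_mul_of_nonneg_left hzn ht0.le).trans this.le
  · simp only at hzw
    rw [div_eq_iff htc] at hzw
    rw [hzw, hudef, ht]
    have : (‖w‖ : ℂ) ≠ 0 := by simpa using hw0
    push_cast
    field_simp

end CaraSector

theorem propositionp (U V : Set ℂ)
    (hUo : IsOpen U) (hUs : IsSimplyConnected U) (hVo : IsOpen V) (hVs : IsSimplyConnected V)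
    (hU : CaraSector.CaratheodoryTendsto (fun t : ℝ => t • U) (fun _ => (-1 : ℂ)) atTop
      CaraSector.slit (-1))
    (hV : CaraSector.CaratheodoryTendsto (fun t : ℝ => t • V) (fun _ => (-1 : ℂ)) atTop
      CaraSector.slit (-1))
    (x : ℕ → ℂ) (hxU : ∀ n, x n ∈ U) (hx0 : Tendsto x atTop (𝓝 0))
    (hxd : Tendsto (fun n => CaraSector.hyperbolicDist U (x n) (x (n + 1))) atTop (𝓝 0))
    (SX : Set ℂ) (hSX : SX ∈ CaraSector.sectors) (hxS : ∀ n, x n ∈ SX)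
    (φ : ℂ → ℂ) (hφ : DifferentiableOn ℂ φ U) (hφV : MapsTo φ U V)
    (lam : ℝ) (hlam : 0 < lam)
    (hφx : (fun n => φ (x n)) ~[atTop] (fun n => (lam : ℂ) * x n)) :
    ((0 : ℂ) ∈ frontier U ∧ (0 : ℂ) ∈ frontier V) ∧
    (∀ S ∈ CaraSector.sectors, φ ~[𝓝[S] 0] (fun z => (lam : ℂ) * z)) ∧
    (∀ S' ∈ CaraSector.sectors, ∀ S ∈ CaraSector.sectors,
      S' ∩ Metric.sphere 0 1 ⊆ interior S →
      ∃ r r' : ℝ, 0 < r ∧ 0 < r' ∧ CaraSector.trunc S r ⊆ U ∧ CaraSector.trunc S' r' ⊆ V ∧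
        CaraSector.trunc S' r' ⊆ φ '' CaraSector.trunc S r) := by
  obtain ⟨α, β, hα, -, hβ, rfl⟩ := hSX
  have hlc : (lam : ℂ) ≠ 0 := by exact_mod_cast hlam.ne'
  have hxne : ∀ n, x n ≠ 0 := fun n => CaraSector.ne_zero_of_mem_sector (hxS n)
  have hφx' : Tendsto (fun n => φ (x n) / x n) atTop (𝓝 (lam : ℂ)) := by
    rw [isEquivalent_iff_tendsto_one
      (Eventually.of_forall fun n => mul_ne_zero hlc (hxne n))] at hφx
    have := hφx.const_mul (lam : ℂ)
    rw [mul_one] at this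
    refine this.congr fun n => ?_
    have := hxne n
    simp only [Pi.div_apply]
    field_simp
  have key := fun z₀ (hz₀ : z₀ ∈ CaraSector.slit) => CaraSector.tendsto_rescaled_map
    hUo hUs hVo hVs hU hV hxU hx0 hxd hα hβ hxS hφ hφV hlam hφx' hz₀
  refine ⟨⟨hU.zero_mem_frontier hUo, hV.zero_mem_frontier hVo⟩, ?_, ?_⟩
  · rintro _ ⟨a, b, ha, -, hb, rfl⟩
    exact CaraSector.isEquivalent_nhdsWithin_sector hlam ha hb key
  · rintro _ ⟨a', b', ha', -, hb', rfl⟩ _ ⟨a, b, ha, -, hb, rfl⟩ hsub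
    exact CaraSector.exists_trunc_subset_image hU hV hφ hlam key ha' hb' ha hb hsub
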